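/- A tournament is a finite loopless directed graph with exactly one directed edge between any two distinct vertices. A directed graph is strongly connected if for all vertices $u,v$ it contains a directed path from $u$ to $v$; a finite directed graph is strongly $m$-connected if it has more than $m$ vertices and remains strongly connected after the removal of any set of at most $m-1$ vertices. A directed graph is $k$-linked if for any two disjoint sets of vertices $\{x_1,\dots,x_k\}$ and $\{y_1,\dots,y_k\}$, each consisting of $k$ distinct vertices, there are pairwise vertex-disjoint directed paths $P_1,\dots,P_k$ such that $P_i$ goes from $x_i$ to $y_i$ for each $i$. **Theorem.** For every integer $k\ge 0$, every strongly $452k$-connected tournament is $k$-linked. -/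

import Mathlib

namespace Digraph

/-- A tournament: a loopless digraph with exactly one directed edge between any two
distinct vertices. -/
structure IsTournament {V : Type*} (G : Digraph V) : Prop where
  irrefl : ∀ v, ¬ G.Adj v v
  existsUnique_edge : ∀ u v, u ≠ v → Xor (G.Adj u v) (G.Adj v u)

/-- The list `p` is the vertex sequence of a directed path of `G` starting at `u` and
ending at `v`: the vertices are distinct and consecutive vertices span edges directed forwards. -/
structure IsDirectedPath {V : Type*} (G : Digraph V) (u v : V) (p : List V) : Prop where
  isChain : p.IsChain G.Adj
  nodup : p.Nodup
  start_eq : p.head? = some u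
  end_eq : p.getLast? = some v

/-- The digraph obtained from `G` by removing the vertices in `S`. -/
def removeVertices {V : Type*} (G : Digraph V) (S : Set V) : Digraph {v : V // v ∉ S} where
  Adj u v := G.Adj u.1 v.1

/-- There is a directed path from every vertex to every vertex. -/
def IsStronglyConnected {V : Type*} (G : Digraph V) : Prop :=
  ∀ u v : V, ∃ p : List V, G.IsDirectedPath u v p

/-- A finite digraph is strongly `k`-connected if it has more than `k` vertices and remains
strongly connected after the removal of any set of at most `k - 1` vertices. -/
def IsStronglyKConnected {V : Type*} [Fintype V] (G : Digraph V) (k : ℕ) : Prop :=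
  k < Fintype.card V ∧
    ∀ S : Finset V, S.card < k → (G.removeVertices (S : Set V)).IsStronglyConnected

/-- `G` is `k`-linked: for any two disjoint sets `{x₁, …, xₖ}`, `{y₁, …, yₖ}` of `k` vertices
there are vertex-disjoint directed paths `P₁, …, Pₖ` with `Pᵢ` going from `xᵢ` to `yᵢ`. -/
def IsLinked {V : Type*} (G : Digraph V) (k : ℕ) : Prop :=
  ∀ x y : Fin k → V, Function.Injective x → Function.Injective y → (∀ i j, x i ≠ y j) →
    ∃ P : Fin k → List V, (∀ i, G.IsDirectedPath (x i) (y i) (P i)) ∧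
      ∀ i j, i ≠ j → List.Disjoint (P i) (P j)

end Digraph

namespace Digraph

open Relation

/-! Let `U` be the set of non-terminals, `I` a set of 120k vertices of `U` of largest in-degree
within `U`, and `O` one of 120k vertices of largest out-degree. In a tournament a vertex with many
out-neighbours reaches every vertex of `I` through at most two intermediate vertices, and so
robustly that 50k disjoint connectors exist (`exists_short_walk`, `exists_short_links`); dually,
every vertex of `O` reaches each `y i`. Menger's theorem (`exists_disjoint_walks`) supplies 120k
disjoint walks from `I` to `O` inside `U`.

A route for the pair `x i`, `y i` is one of these walks with a connector at each end. The walks may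
be long, but distinct ones are disjoint, and the two connectors of a route have at most four inner
vertices. Hence the routes of two pairs collide for a fraction of at most 9/(120k) + 8/(50k) <
1/(4k) of the choices (`card_conflict_le`). A union bound over all pairs of indices is too weak, but
each index takes part in fewer than k conflicts, so a counting argument in the style of the local
lemma (`exists_conflict_free`) selects disjoint routes. -/

/-! ### Walks confined to a vertex set. -/

/-- A step of `r` between two vertices of `W`. -/
def RelWithin {V : Type*} (r : V → V → Prop) (W : Finset V) (a b : V) : Prop :=
  r a b ∧ a ∈ W ∧ b ∈ W

theorem RelWithin.mono {V : Type*} {r : V → V → Prop} {W W' : Finset V} (h : W ⊆ W') {a b : V}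
    (hab : ReflTransGen (RelWithin r W) a b) : ReflTransGen (RelWithin r W') a b :=
  ReflTransGen.mono (fun _ _ h' => ⟨h'.1, h h'.2.1, h h'.2.2⟩) _ _ hab

theorem RelWithin.swap {V : Type*} {r : V → V → Prop} {W : Finset V} {a b : V}
    (hab : ReflTransGen (RelWithin r W) a b) :
    ReflTransGen (RelWithin (fun u v => r v u) W) b a :=
  ReflTransGen.mono (fun _ _ h => ⟨h.1, h.2.2, h.2.1⟩) _ _ hab.swap

/-- A walk inside `W` contains a directed path inside `W`. -/
theorem exists_isDirectedPath {V : Type*} (G : Digraph V) (W : Finset V) {u v : V}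
    (hv : v ∈ W) (h : ReflTransGen (RelWithin G.Adj W) u v) :
    ∃ p : List V, G.IsDirectedPath u v p ∧ ∀ w ∈ p, w ∈ W := by
  classical
  induction h using ReflTransGen.head_induction_on with
  | refl => exact ⟨[v], ⟨by simp, by simp, by simp, by simp⟩, by simpa⟩
  | @head a c hac _ ih =>
    obtain ⟨p, hp, hW⟩ := ih
    -- If `a` already lies on the path, the part of the path from `a` onwards suffices.
    by_cases hap : a ∈ p
    · obtain ⟨s, t, rfl⟩ := List.append_of_mem hap
      refine ⟨a :: t, ⟨(List.isChain_append.1 hp.isChain).2.1, (List.nodup_append.1 hp.nodup).2.1,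
        by simp, ?_⟩, fun w hw => hW w (List.mem_append_right _ hw)⟩
      have := hp.end_eq
      rw [List.getLast?_append] at this
      simpa using this
    · have hs := hp.start_eq
      cases p with
      | nil => simp at hs
      | cons d q =>
        obtain rfl : d = c := by simpa using hs
        refine ⟨a :: d :: q, ⟨List.isChain_cons_cons.2 ⟨hac.1, hp.isChain⟩,
          List.nodup_cons.2 ⟨hap, hp.nodup⟩, by simp, ?_⟩, ?_⟩
        · have := hp.end_eq
          rw [List.getLast?_cons_cons]
          exact this
        · intro w hw
          rcases List.mem_cons.1 hw with rfl | hw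
          · exact hac.2.1
          · exact hW w hw

/-! ### Menger's theorem, deduced from Hall's theorem. -/

/-- Menger's theorem for walks between two vertex sets, in terms of a relation `r`. -/
theorem exists_disjoint_walks {V : Type*} [Fintype V] [DecidableEq V] (r : V → V → Prop)
    (A B : Finset V)
    (h : ∀ S : Finset V, S.card < A.card → ∃ a ∈ A, ∃ b ∈ B, a ∉ S ∧
      ReflTransGen (fun u v => r u v ∧ v ∉ S) a b) :
    ∃ (Q : V → Finset V) (e : V → V),
      (∀ a ∈ A, e a ∈ B ∧ a ∈ Q a ∧ e a ∈ Q a ∧ ReflTransGen (RelWithin r (Q a)) a (e a) ∧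
        ∀ v ∈ Q a, v ∈ A ∨ ∃ u, r u v) ∧
      ∀ a ∈ A, ∀ a' ∈ A, a ≠ a' → Disjoint (Q a) (Q a') := by
  classical
  -- A system of distinct representatives for `t` is an injective successor map from the complement
  -- of `B` to the complement of `A`; a fixed point is a vertex that no walk uses.
  let t : {v // v ∉ B} → Finset V := fun v =>
    Finset.univ.filter fun w => w ∉ A ∧ (w = v ∨ r v w)
  have hall : ∀ s : Finset {v // v ∉ B}, s.card ≤ (s.biUnion t).card := by
    intro s
    set L : Finset V := s.map (Function.Embedding.subtype _) with hL
    set N : Finset V := s.biUnion t with hN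
    have hLs : L.card = s.card := Finset.card_map _
    have hLB : ∀ v ∈ L, v ∉ B := by
      intro v hv
      simp only [hL, Finset.mem_map, Function.Embedding.subtype_apply] at hv
      obtain ⟨w, -, rfl⟩ := hv
      exact w.2
    have hNmem : ∀ v ∈ L, ∀ w, w ∉ A → (w = v ∨ r v w) → w ∈ N := by
      intro v hv w hw hvw
      simp only [hL, Finset.mem_map, Function.Embedding.subtype_apply] at hv
      obtain ⟨v', hv', rfl⟩ := hv
      simp only [hN, Finset.mem_biUnion]
      exact ⟨v', hv', by simp [t, hw, hvw]⟩
    -- This set meets every walk from `A` to `B`: a walk avoiding it starts in `L` and can never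
    -- leave `L`, which misses `B`.
    have hsep : A.card ≤ ((A \ L) ∪ (N \ L)).card := by
      by_contra hlt
      obtain ⟨a, ha, b, hb, haS, hab⟩ := h _ (not_le.1 hlt)
      have haL : a ∈ L := by
        by_contra haL
        exact haS (Finset.mem_union_left _ (Finset.mem_sdiff.2 ⟨ha, haL⟩))
      have hinv : ∀ c, ReflTransGen (fun u v => r u v ∧ v ∉ (A \ L) ∪ (N \ L)) a c → c ∈ L := by
        intro c hc
        induction hc with
        | refl => exact haL
        | @tail c d _ hcd ih =>
          by_contra hd
          apply hcd.2
          by_cases hdA : d ∈ A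
          · exact Finset.mem_union_left _ (Finset.mem_sdiff.2 ⟨hdA, hd⟩)
          · exact Finset.mem_union_right _
              (Finset.mem_sdiff.2 ⟨hNmem c ih d hdA (Or.inr hcd.1), hd⟩)
      exact hLB b (hinv b hab) hb
    have h1 : (L \ A) ∪ (N \ L) ⊆ N := by
      intro v hv
      rcases Finset.mem_union.1 hv with hv | hv
      · exact hNmem v (Finset.mem_sdiff.1 hv).1 v (Finset.mem_sdiff.1 hv).2 (Or.inl rfl)
      · exact (Finset.mem_sdiff.1 hv).1
    have h2 : Disjoint (L \ A) (N \ L) :=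
      Finset.disjoint_left.2 fun v hv hv' => (Finset.mem_sdiff.1 hv').2 (Finset.mem_sdiff.1 hv).1
    have h3 := Finset.card_le_card h1
    rw [Finset.card_union_of_disjoint h2] at h3
    have h4 := Finset.card_union_le (A \ L) (N \ L)
    have h5 := Finset.card_sdiff_add_card_inter L A
    have h6 := Finset.card_sdiff_add_card_inter A L
    rw [Finset.inter_comm] at h6
    omega
  obtain ⟨σ, hσinj, hσ⟩ := (Finset.all_card_le_biUnion_card_iff_exists_injective t).1 hall
  let τ : V → V := fun v => if hv : v ∈ B then v else σ ⟨v, hv⟩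
  have hτA : ∀ v, v ∉ B → τ v ∉ A := by
    intro v hv
    have := hσ ⟨v, hv⟩
    simp only [t, Finset.mem_filter] at this
    simp only [τ, hv, dite_false]
    exact this.2.1
  have hτr : ∀ v, v ∉ B → τ v = v ∨ r v (τ v) := by
    intro v hv
    have := hσ ⟨v, hv⟩
    simp only [t, Finset.mem_filter] at this
    simp only [τ, hv, dite_false]
    exact this.2.2
  have hτinj : ∀ v w, v ∉ B → w ∉ B → τ v = τ w → v = w := by
    intro v w hv hw hvw
    simp only [τ, hv, hw, dite_false] at hvw
    simpa using hσinj hvw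
  -- Equal iterates are traced back by injectivity of `τ` off `B`; neither orbit can reach its start
  -- earlier than the other, as `τ` never maps a vertex off `B` into `A`.
  have hinj : ∀ i j a a', a ∈ A → a' ∈ A → (∀ l < i, τ^[l] a ∉ B) → (∀ l < j, τ^[l] a' ∉ B) →
      τ^[i] a = τ^[j] a' → i = j ∧ a = a' := by
    intro i
    induction i with
    | zero =>
      intro j a a' ha ha' _ hj heq
      cases j with
      | zero => exact ⟨rfl, heq⟩
      | succ j =>
        rw [Function.iterate_succ_apply'] at heq
        exact absurd (heq ▸ ha) (hτA _ (hj j (Nat.lt_succ_self j)))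
    | succ i ih =>
      intro j a a' ha ha' hi hj heq
      cases j with
      | zero =>
        rw [Function.iterate_succ_apply'] at heq
        exact absurd (show τ (τ^[i] a) ∈ A from heq ▸ ha') (hτA _ (hi i (Nat.lt_succ_self i)))
      | succ j =>
        rw [Function.iterate_succ_apply', Function.iterate_succ_apply'] at heq
        have := ih j a a' ha ha' (fun l hl => hi l (hl.trans (Nat.lt_succ_self i)))
          (fun l hl => hj l (hl.trans (Nat.lt_succ_self j)))
          (hτinj _ _ (hi i (Nat.lt_succ_self i)) (hj j (Nat.lt_succ_self j)) heq)
        exact ⟨by rw [this.1], this.2⟩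
  have hex : ∀ a ∈ A, ∃ n, τ^[n] a ∈ B := by
    intro a ha
    by_contra hne
    push Not at hne
    exact not_injective_infinite_finite (fun n : ℕ => τ^[n] a) fun i j hij =>
      (hinj i j a a ha ha (fun l _ => hne l) (fun l _ => hne l) hij).1
  have hex' : ∀ a, ∃ n, a ∈ A → τ^[n] a ∈ B ∧ ∀ l < n, τ^[l] a ∉ B := by
    intro a
    by_cases ha : a ∈ A
    · exact ⟨Nat.find (hex a ha), fun _ => ⟨Nat.find_spec (hex a ha),
        fun l hl => Nat.find_min (hex a ha) hl⟩⟩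
    · exact ⟨0, fun h => absurd h ha⟩
  choose n hn using hex'
  refine ⟨fun a => (Finset.range (n a + 1)).image fun i => τ^[i] a, fun a => τ^[n a] a, ?_, ?_⟩
  · intro a ha
    have hmem : ∀ i ≤ n a, τ^[i] a ∈ (Finset.range (n a + 1)).image fun i => τ^[i] a :=
      fun i hi => Finset.mem_image_of_mem _ (Finset.mem_range.2 (Nat.lt_succ_of_le hi))
    have hstep : ∀ i < n a, r (τ^[i] a) (τ^[i + 1] a) := by
      intro i hi
      have h1 := (hn a ha).2 i hi
      rcases hτr _ h1 with h2 | h2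
      · rw [← Function.iterate_succ_apply' τ] at h2
        have := (hinj (i + 1) i a a ha ha (fun l hl => (hn a ha).2 l (by omega))
          (fun l hl => (hn a ha).2 l (by omega)) h2).1
        omega
      · rwa [← Function.iterate_succ_apply' τ] at h2
    refine ⟨(hn a ha).1, hmem 0 (Nat.zero_le _), hmem _ le_rfl, ?_, ?_⟩
    · have : ∀ i ≤ n a, ReflTransGen
          (RelWithin r ((Finset.range (n a + 1)).image fun i => τ^[i] a)) a (τ^[i] a) := by
        intro i
        induction i with
        | zero => exact fun _ => ReflTransGen.refl
        | succ i ih =>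
          exact fun hi => (ih (by omega)).tail ⟨hstep i hi, hmem i (by omega), hmem _ hi⟩
      exact this _ le_rfl
    · intro v hv
      obtain ⟨i, hi, rfl⟩ := Finset.mem_image.1 hv
      cases i with
      | zero => exact Or.inl ha
      | succ i => exact Or.inr ⟨_, hstep i (by simpa using hi)⟩
  · intro a ha a' ha' hne
    refine Finset.disjoint_left.2 fun v hv hv' => hne ?_
    obtain ⟨i, hi, rfl⟩ := Finset.mem_image.1 hv
    obtain ⟨j, hj, heq⟩ := Finset.mem_image.1 hv'
    rw [Finset.mem_range] at hi hj
    exact (hinj i j a a' ha ha' (fun l hl => (hn a ha).2 l (by omega))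
      (fun l hl => (hn a' ha').2 l (by omega)) heq.symm).2

/-! ### Short walks in tournaments and greedy disjoint families. -/

/-- A set that spans a tournament and has all inner in-degrees at most `f` has at most `2 * f + 1`
vertices. -/
theorem card_le_of_inDegree_le {V : Type*} [DecidableEq V] (r : V → V → Prop) [DecidableRel r]
    (hr : ∀ u v, u ≠ v → r u v ∨ r v u) (A : Finset V) (f : ℕ)
    (hf : ∀ a ∈ A, (A.filter fun b => r b a).card ≤ f) : A.card ≤ 2 * f + 1 := by
  by_contra! hlt
  let E : Finset (V × V) := (A ×ˢ A).filter fun x => r x.1 x.2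
  have hE : E.card ≤ A.card * f := by
    have h1 : E ⊆ A.biUnion fun a => (A.filter fun b => r b a).image fun b => (b, a) := by
      rintro ⟨b, a⟩ hx
      simp only [E, Finset.mem_filter, Finset.mem_product] at hx
      simp only [Finset.mem_biUnion, Finset.mem_image, Finset.mem_filter]
      exact ⟨a, hx.1.2, b, ⟨hx.1.1, hx.2⟩, rfl⟩
    exact (Finset.card_le_card h1).trans
      (Finset.card_biUnion_le_card_mul _ _ _ fun a ha => Finset.card_image_le.trans (hf a ha))
  -- Each ordered pair is diagonal, an edge or a reversed edge, so |A|² ≤ |A| + 2f|A|.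
  have h2 : A ×ˢ A ⊆ A.image (fun a => (a, a)) ∪ (E ∪ E.image Prod.swap) := by
    rintro ⟨a, b⟩ hx
    obtain ⟨ha, hb⟩ := Finset.mem_product.1 hx
    simp only at ha hb
    by_cases hab : a = b
    · subst hab
      exact Finset.mem_union_left _ (Finset.mem_image_of_mem _ ha)
    · refine Finset.mem_union_right _ ?_
      rcases hr a b hab with h | h
      · exact Finset.mem_union_left _ (by simp [E, ha, hb, h])
      · exact Finset.mem_union_right _ (Finset.mem_image.2 ⟨(b, a), by simp [E, ha, hb, h], rfl⟩)
  have h3 := Finset.card_le_card h2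
  have h4 := Finset.card_union_le (A.image fun a => (a, a)) (E ∪ E.image Prod.swap)
  have h5 := Finset.card_union_le E (E.image Prod.swap)
  have h6 : (A.image fun a => (a, a)).card ≤ A.card := Finset.card_image_le
  have h7 : (E.image Prod.swap).card ≤ E.card := Finset.card_image_le
  rw [Finset.card_product] at h3
  nlinarith

/-- There is a set of `p` elements of largest value of `d`. -/
theorem exists_subset_card_eq_of_max {V : Type*} [DecidableEq V] (U : Finset V) (d : V → ℕ) (p : ℕ)
    (hp : p ≤ U.card) : ∃ I ⊆ U, I.card = p ∧ ∀ v ∈ I, ∀ w ∈ U, w ∉ I → d w ≤ d v := by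
  induction p with
  | zero => exact ⟨∅, by simp, by simp, by simp⟩
  | succ p ih =>
    obtain ⟨I, hIU, hIp, hI⟩ := ih (by omega)
    have hne : (U \ I).Nonempty := by
      rw [← Finset.card_pos, Finset.card_sdiff_of_subset hIU]
      omega
    obtain ⟨z, hz, hzmax⟩ := Finset.exists_max_image _ d hne
    obtain ⟨hzU, hzI⟩ := Finset.mem_sdiff.1 hz
    refine ⟨insert z I, Finset.insert_subset hzU hIU, by rw [Finset.card_insert_of_notMem hzI, hIp],
      ?_⟩
    intro v hv w hw hwI
    rw [Finset.mem_insert, not_or] at hwI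
    rcases Finset.mem_insert.1 hv with rfl | hv
    · exact hzmax w (Finset.mem_sdiff.2 ⟨hw, hwI.2⟩)
    · exact hI v hv w hw hwI.2

/-- A vertex with many out-neighbours has a short walk, avoiding any given small set, to each of
the vertices of largest in-degree. -/
theorem exists_short_walk {V : Type*} [DecidableEq V] (r : V → V → Prop) [DecidableRel r]
    (hr : ∀ u v, u ≠ v → r u v ∨ r v u) (U I : Finset V)
    (hI : ∀ v ∈ I, ∀ w ∈ U, w ∉ I →
      (U.filter fun b => r b w).card ≤ (U.filter fun b => r b v).card)
    {f m : ℕ} (hm : 3 * f + I.card + 1 < m) {x v : V} (hv : v ∈ I)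
    (hx : m ≤ (U.filter fun b => r x b).card) (F : Finset V) (hF : F.card ≤ f) :
    ∃ P ⊆ U \ F, P.card ≤ 2 ∧ ReflTransGen (RelWithin r (insert x (insert v P))) x v := by
  by_contra hno
  have hno' : ∀ P ⊆ U \ F, P.card ≤ 2 →
      ¬ ReflTransGen (RelWithin r (insert x (insert v P))) x v :=
    fun P h1 h2 h3 => hno ⟨P, h1, h2, h3⟩
  set A := (U.filter fun b => r x b) \ F with hA
  set B := (U.filter fun b => r b v) \ F with hB
  have hAmem : ∀ a ∈ A, (a ∈ U ∧ a ∉ F) ∧ r x a := by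
    intro a ha
    simp only [hA, Finset.mem_sdiff, Finset.mem_filter] at ha
    tauto
  have hBmem : ∀ a ∈ B, (a ∈ U ∧ a ∉ F) ∧ r a v := by
    intro a ha
    simp only [hB, Finset.mem_sdiff, Finset.mem_filter] at ha
    tauto
  -- A common vertex would give a walk with one inner vertex, and an edge from `A` to `B` one with
  -- two; hence all edges between the sets go from `B` to `A`.
  have hAB : Disjoint A B := by
    refine Finset.disjoint_left.2 fun a ha hb => hno' {a} ?_ (by simp) ?_
    · simpa using (hAmem a ha).1
    · exact (ReflTransGen.single ⟨(hAmem a ha).2, by simp, by simp⟩).tail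
        ⟨(hBmem a hb).2, by simp, by simp⟩
  have hBA : ∀ b ∈ B, ∀ a ∈ A, r b a := by
    intro b hb a ha
    have hne : a ≠ b := fun h => Finset.disjoint_left.1 hAB ha (h ▸ hb)
    refine (hr a b hne).resolve_left fun hab => hno' {a, b} ?_ Finset.card_le_two ?_
    · intro c hc
      rcases Finset.mem_insert.1 hc with rfl | hc
      · exact Finset.mem_sdiff.2 (hAmem _ ha).1
      · rw [Finset.mem_singleton.1 hc]
        exact Finset.mem_sdiff.2 (hBmem _ hb).1
    · exact ((ReflTransGen.single ⟨(hAmem a ha).2, by simp, by simp⟩).tail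
        ⟨hab, by simp, by simp⟩).tail ⟨(hBmem b hb).2, by simp, by simp⟩
  have hcardA : m ≤ A.card + f := by
    have := Finset.le_card_sdiff F (U.filter fun b => r x b)
    rw [← hA] at this
    omega
  have hcardB : (U.filter fun b => r b v).card ≤ B.card + f := by
    have := Finset.le_card_sdiff F (U.filter fun b => r b v)
    rw [← hB] at this
    omega
  -- The in-degree of `a` counts all of `B` and is at most that of `v`, which is at most |B| + f.
  -- Only `f` in-neighbours remain for `A \ I`, which is too large for that.
  have hdeg : ∀ a ∈ A \ I, ((A \ I).filter fun b => r b a).card ≤ f := by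
    intro a ha
    obtain ⟨haA, haI⟩ := Finset.mem_sdiff.1 ha
    have h1 := hI v hv a (hAmem a haA).1.1 haI
    have h2 : B ∪ (A \ I).filter (fun b => r b a) ⊆ U.filter fun b => r b a := by
      intro b hb
      rw [Finset.mem_filter]
      rcases Finset.mem_union.1 hb with hb | hb
      · exact ⟨(hBmem b hb).1.1, hBA b hb a haA⟩
      · obtain ⟨hb, hba⟩ := Finset.mem_filter.1 hb
        exact ⟨(hAmem b (Finset.mem_sdiff.1 hb).1).1.1, hba⟩
    have h3 : Disjoint B ((A \ I).filter fun b => r b a) :=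
      hAB.symm.mono_right ((Finset.filter_subset _ _).trans Finset.sdiff_subset)
    have h4 := Finset.card_le_card h2
    rw [Finset.card_union_of_disjoint h3] at h4
    omega
  have h1 := card_le_of_inDegree_le r hr (A \ I) f hdeg
  have h2 := Finset.le_card_sdiff I A
  omega

/-- A greedy choice of pairwise disjoint sets. -/
theorem exists_pairwise_disjoint {V : Type*} [DecidableEq V] (good : Finset V → Prop) (c s : ℕ)
    (h : ∀ F : Finset V, F.card ≤ c * s → ∃ P, Disjoint P F ∧ P.card ≤ c ∧ good P) :
    ∃ P : Fin s → Finset V, (∀ i, (P i).card ≤ c ∧ good (P i)) ∧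
      ∀ i j, i ≠ j → Disjoint (P i) (P j) := by
  have key : ∀ t ≤ s, ∃ P : Fin t → Finset V, (∀ i, (P i).card ≤ c ∧ good (P i)) ∧
      ∀ i j, i ≠ j → Disjoint (P i) (P j) := by
    intro t
    induction t with
    | zero => exact fun _ => ⟨fun _ => ∅, fun i => i.elim0, fun i => i.elim0⟩
    | succ t ih =>
      intro ht
      obtain ⟨P, hP, hdis⟩ := ih (by omega)
      obtain ⟨R, hR, hRc, hRg⟩ := h (Finset.univ.biUnion P) (by
        refine (Finset.card_biUnion_le_card_mul _ _ c fun i _ => (hP i).1).trans ?_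
        rw [Finset.card_univ, Fintype.card_fin, mul_comm]
        exact Nat.mul_le_mul_left _ (by omega))
      have hR' : ∀ i, Disjoint R (P i) := fun i =>
        hR.mono_right (Finset.subset_biUnion_of_mem P (Finset.mem_univ i))
      refine ⟨Fin.snoc P R, ?_, ?_⟩
      · intro i
        induction i using Fin.lastCases with
        | last => simpa using ⟨hRc, hRg⟩
        | cast i => simpa using hP i
      · intro i j hij
        induction i using Fin.lastCases with
        | last =>
          induction j using Fin.lastCases with
          | last => exact absurd rfl hij
          | cast j => simpa using hR' j
        | cast i =>
          induction j using Fin.lastCases with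
          | last => simpa using (hR' i).symm
          | cast j => simpa using hdis i j fun h => hij (h ▸ rfl)
  exact key s le_rfl

/-! ### Choices without conflicts, by counting. -/

/-- An event on two coordinates is independent of a property of functions that does not depend on
these coordinates. -/
theorem card_filter_mul_le {ι C : Type*} [Fintype ι] [DecidableEq ι] [Fintype C]
    (G : (ι → C) → Prop) [DecidablePred G] {i j : ι} (hij : i ≠ j)
    (hG : ∀ f c d, G f → G (Function.update (Function.update f i c) j d))
    (E : C → C → Prop) [DecidableRel E] :
    (Finset.univ.filter fun f => G f ∧ E (f i) (f j)).card * Fintype.card C ^ 2 ≤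
      (Finset.univ.filter G).card * (Finset.univ.filter fun x : C × C => E x.1 x.2).card := by
  have hC : Fintype.card C ^ 2 = (Finset.univ : Finset (C × C)).card := by
    rw [Finset.card_univ, Fintype.card_prod, sq]
  rw [hC, ← Finset.card_product, ← Finset.card_product]
  -- The values of the function at `i` and `j` are exchanged with the given pair, which loses no
  -- information.
  refine Finset.card_le_card_of_injOn
    (fun x => (Function.update (Function.update x.1 i x.2.1) j x.2.2, (x.1 i, x.1 j))) ?_ ?_
  · rintro ⟨f, c, d⟩ hx
    simp only [Finset.coe_product, Set.mem_prod, Finset.mem_coe, Finset.mem_filter,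
      Finset.mem_univ, true_and, and_true] at hx ⊢
    exact ⟨hG f c d hx.1, hx.2⟩
  · rintro ⟨f, c, d⟩ - ⟨f', c', d'⟩ - h
    simp only [Prod.mk.injEq] at h
    obtain ⟨h1, h2, h3⟩ := h
    have hd : d = d' := by simpa using congrFun h1 j
    have hc : c = c' := by simpa [Function.update_of_ne hij] using congrFun h1 i
    have hf : f = f' := by
      funext l
      by_cases hlj : l = j
      · rw [hlj, h3]
      by_cases hli : l = i
      · rw [hli, h2]
      simpa [Function.update_of_ne hlj, Function.update_of_ne hli] using congrFun h1 l
    rw [hd, hc, hf]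

/-- If each pair of indices is in conflict for a fraction of at most `1 / (4 * |ι|)` of the pairs
of choices, then there is a choice without conflicts. -/
theorem exists_conflict_free {ι C : Type*} [Fintype ι] [DecidableEq ι] [Fintype C] [Nonempty C]
    (conf : ι → ι → C → C → Prop) (hsymm : ∀ i j c d, conf i j c d → conf j i d c)
    (hconf : ∀ i j, i ≠ j → ∀ s : Finset (C × C), (∀ x ∈ s, conf i j x.1 x.2) →
      4 * Fintype.card ι * s.card ≤ Fintype.card C ^ 2) :
    ∃ f : ι → C, ∀ i j, i ≠ j → ¬ conf i j (f i) (f j) := by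
  classical
  let G : Finset ι → (ι → C) → Prop := fun S f =>
    ∀ i ∈ S, ∀ j ∈ S, i ≠ j → ¬ conf i j (f i) (f j)
  let N : Finset ι → ℕ := fun S => (Finset.univ.filter (G S)).card
  have hC : 0 < Fintype.card C := Fintype.card_pos
  have key : ∀ n, ∀ S : Finset ι, S.card = n → ∀ i ∉ S, N S ≤ 2 * N (insert i S) := by
    intro n
    induction n using Nat.strong_induction_on with
    | _ n ih =>
    intro S hS i hi
    -- Dropping `j` from `S` frees both coordinates `i` and `j`, so independence applies. Induction
    -- then costs a factor 2 for restoring `j`: |D j| is at most N S / (2|ι|), and all the `D j`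
    -- together spoil at most half of N S.
    let D : ι → Finset (ι → C) := fun j =>
      Finset.univ.filter fun f => G (S.erase j) f ∧ conf i j (f i) (f j)
    have hD : ∀ j ∈ S, 2 * Fintype.card ι * (D j).card ≤ N S := by
      intro j hj
      have hij : i ≠ j := fun h => hi (h ▸ hj)
      have h1 := card_filter_mul_le (G (S.erase j)) hij (by
        intro f c d hf a ha b hb hab
        have haj := Finset.ne_of_mem_erase ha
        have hbj := Finset.ne_of_mem_erase hb
        have hai : a ≠ i := fun h => hi (h ▸ Finset.mem_of_mem_erase ha)
        have hbi : b ≠ i := fun h => hi (h ▸ Finset.mem_of_mem_erase hb)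
        simpa [Function.update_of_ne, *] using hf a ha b hb hab) (conf i j)
      have h2 := hconf i j hij (Finset.univ.filter fun x : C × C => conf i j x.1 x.2) (by simp)
      have h3 := ih (S.erase j).card (hS ▸ Finset.card_erase_lt_of_mem hj) (S.erase j) rfl j
        (Finset.notMem_erase j S)
      rw [Finset.insert_erase hj] at h3
      have h4 : 4 * Fintype.card ι * (D j).card * Fintype.card C ^ 2 ≤
          N (S.erase j) * Fintype.card C ^ 2 :=
        calc _ = 4 * Fintype.card ι * ((D j).card * Fintype.card C ^ 2) := by ring
          _ ≤ 4 * Fintype.card ι * (N (S.erase j) *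
              (Finset.univ.filter fun x : C × C => conf i j x.1 x.2).card) :=
            Nat.mul_le_mul_left _ h1
          _ = N (S.erase j) * (4 * Fintype.card ι *
              (Finset.univ.filter fun x : C × C => conf i j x.1 x.2).card) := by ring
          _ ≤ _ := Nat.mul_le_mul_left _ h2
      have h5 := Nat.le_of_mul_le_mul_right h4 (by positivity)
      linarith
    have hsub : Finset.univ.filter (G S) ⊆
        Finset.univ.filter (G (insert i S)) ∪ S.biUnion D := by
      intro f hf
      rw [Finset.mem_filter] at hf
      by_cases hg : G (insert i S) f
      · exact Finset.mem_union_left _ (by simpa using hg)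
      · refine Finset.mem_union_right _ ?_
        have hGS := hf.2
        have hex : ∃ j ∈ S, conf i j (f i) (f j) := by
          by_contra! hne
          apply hg
          intro a ha b hb hab
          rcases Finset.mem_insert.1 ha with hai | haS
          · rcases Finset.mem_insert.1 hb with hbi | hbS
            · exact absurd (hai.trans hbi.symm) hab
            · exact hai ▸ hne b hbS
          · rcases Finset.mem_insert.1 hb with hbi | hbS
            · exact hbi ▸ fun h => hne a haS (hsymm _ _ _ _ h)
            · exact hGS a haS b hbS hab
        obtain ⟨j, hj, hjc⟩ := hex
        refine Finset.mem_biUnion.2 ⟨j, hj, Finset.mem_filter.2 ⟨Finset.mem_univ _, ?_, hjc⟩⟩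
        exact fun a ha b hb => hGS a (Finset.mem_of_mem_erase ha) b (Finset.mem_of_mem_erase hb)
    have h1 := (Finset.card_le_card hsub).trans (Finset.card_union_le _ _)
    have h2 : (S.biUnion D).card ≤ ∑ j ∈ S, (D j).card := Finset.card_biUnion_le
    have h3 : 2 * Fintype.card ι * ∑ j ∈ S, (D j).card ≤ Fintype.card ι * N S := by
      rw [Finset.mul_sum]
      refine (Finset.sum_le_card_nsmul _ _ _ hD).trans ?_
      rw [smul_eq_mul]
      exact Nat.mul_le_mul_right _ (Finset.card_le_univ S)
    have hι : 0 < Fintype.card ι := Fintype.card_pos_iff.2 ⟨i⟩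
    have h4 : 2 * ∑ j ∈ S, (D j).card ≤ N S :=
      Nat.le_of_mul_le_mul_left (by linarith) hι
    change N S ≤ N (insert i S) + _ at h1
    omega
  have hpos : ∀ S : Finset ι, 0 < N S := by
    intro S
    induction S using Finset.induction_on with
    | empty =>
      obtain ⟨c⟩ := ‹Nonempty C›
      exact Finset.card_pos.2 ⟨fun _ => c, by simp [G]⟩
    | insert i S hi ih =>
      have := key _ S rfl i hi
      omega
  obtain ⟨f, hf⟩ := Finset.card_pos.1 (hpos Finset.univ)
  exact ⟨f, fun i j => (Finset.mem_filter.1 hf).2 i (Finset.mem_univ i) j (Finset.mem_univ j)⟩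

/-! ### Counting collisions between routes. -/

/-- A set meets at most as many members of a disjoint family as it has elements. -/
theorem card_filter_not_disjoint_le {ι V : Type*} [Fintype ι] [DecidableEq V]
    (Q : ι → Finset V) (hQ : ∀ i j, i ≠ j → Disjoint (Q i) (Q j)) (K : Finset V) :
    (Finset.univ.filter fun i => ¬ Disjoint K (Q i)).card ≤ K.card := by
  classical
  have h : (Finset.univ.filter fun i => ¬ Disjoint K (Q i)) ⊆
      K.biUnion fun v => Finset.univ.filter fun i => v ∈ Q i := by
    intro i hi
    obtain ⟨v, hvK, hvQ⟩ := Finset.not_disjoint_iff.1 (Finset.mem_filter.1 hi).2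
    exact Finset.mem_biUnion.2 ⟨v, hvK, by simpa using hvQ⟩
  refine (Finset.card_le_card h).trans ((Finset.card_biUnion_le_card_mul _ _ 1 ?_).trans_eq
    (mul_one _))
  refine fun v _ => Finset.card_le_one.2 fun i hi j hj => ?_
  by_contra hij
  exact Finset.disjoint_left.1 (hQ i j hij) (Finset.mem_filter.1 hi).2 (Finset.mem_filter.1 hj).2

/-- A set of at most four vertices meets few of the choices of connecting walks. -/
theorem card_fiber_le {L V : Type*} [Fintype L] [DecidableEq L] [DecidableEq V] {s : ℕ}
    (Q : L → Finset V) (P R : L → Fin s → Finset V)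
    (hQ : ∀ l l', l ≠ l' → Disjoint (Q l) (Q l'))
    (hP : ∀ l α α', α ≠ α' → Disjoint (P l α) (P l α'))
    (hR : ∀ l α α', α ≠ α' → Disjoint (R l α) (R l α'))
    (K : Finset V) (hK : K.card ≤ 4) (T : Finset (L × Fin s × Fin s))
    (hT : ∀ c ∈ T, ¬ Disjoint K (Q c.1) ∨ ¬ Disjoint K (P c.1 c.2.1) ∨
      ¬ Disjoint K (R c.1 c.2.2)) :
    T.card ≤ 4 * s ^ 2 + 8 * Fintype.card L * s := by
  -- `K` meets at most four sets `Q l`, each lying in s² triples; for each `l` it meets at most four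
  -- `P l α` and four `R l β`, each lying in s triples with that `l`.
  let T1 : Finset (L × Fin s × Fin s) :=
    (Finset.univ.filter fun l => ¬ Disjoint K (Q l)) ×ˢ Finset.univ
  let T2 : Finset (L × Fin s × Fin s) := Finset.univ.biUnion fun l =>
    {l} ×ˢ ((Finset.univ.filter fun α => ¬ Disjoint K (P l α)) ×ˢ Finset.univ)
  let T3 : Finset (L × Fin s × Fin s) := Finset.univ.biUnion fun l =>
    {l} ×ˢ (Finset.univ ×ˢ (Finset.univ.filter fun α => ¬ Disjoint K (R l α)))
  have hsub : T ⊆ T1 ∪ (T2 ∪ T3) := by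
    rintro ⟨l, α, β⟩ hc
    rcases hT _ hc with h | h | h
    · exact Finset.mem_union_left _ (by simpa [T1] using h)
    · exact Finset.mem_union_right _ (Finset.mem_union_left _ (by simpa [T2] using h))
    · exact Finset.mem_union_right _ (Finset.mem_union_right _ (by simpa [T3] using h))
  have h1 : T1.card ≤ 4 * s ^ 2 := by
    simp only [T1, Finset.card_product, Finset.card_univ, Fintype.card_prod, Fintype.card_fin]
    rw [sq]
    exact Nat.mul_le_mul_right _ ((card_filter_not_disjoint_le Q hQ K).trans hK)
  have h2 : T2.card ≤ Fintype.card L * (4 * s) := by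
    refine Finset.card_biUnion_le_card_mul _ _ _ fun l _ => ?_
    simp only [Finset.card_product, Finset.card_univ, Fintype.card_fin, Finset.card_singleton,
      one_mul]
    exact Nat.mul_le_mul_right _ ((card_filter_not_disjoint_le (P l) (hP l) K).trans hK)
  have h3 : T3.card ≤ Fintype.card L * (4 * s) := by
    refine Finset.card_biUnion_le_card_mul _ _ _ fun l _ => ?_
    simp only [Finset.card_product, Finset.card_univ, Fintype.card_fin, Finset.card_singleton,
      one_mul]
    rw [mul_comm]
    exact Nat.mul_le_mul_right _ ((card_filter_not_disjoint_le (R l) (hR l) K).trans hK)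
  have h4 := (Finset.card_le_card hsub).trans (Finset.card_union_le _ _)
  have h5 := Finset.card_union_le T2 T3
  linarith

/-- Few pairs of choices of connecting walks meet. -/
theorem card_conflict_le {L V : Type*} [Fintype L] [DecidableEq L] [DecidableEq V] {s : ℕ}
    (Q : L → Finset V) (P R P' R' : L → Fin s → Finset V)
    (hQ : ∀ l l', l ≠ l' → Disjoint (Q l) (Q l'))
    (hP : ∀ l α α', α ≠ α' → Disjoint (P l α) (P l α'))
    (hR : ∀ l α α', α ≠ α' → Disjoint (R l α) (R l α'))
    (hPc : ∀ l α, (P l α).card ≤ 2) (hRc : ∀ l α, (R l α).card ≤ 2)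
    (hPc' : ∀ l α, (P' l α).card ≤ 2) (hRc' : ∀ l α, (R' l α).card ≤ 2)
    (E : Finset ((L × Fin s × Fin s) × (L × Fin s × Fin s)))
    (hE : ∀ x ∈ E, ¬ Disjoint (P x.1.1 x.1.2.1 ∪ R x.1.1 x.1.2.2 ∪ Q x.1.1)
      (P' x.2.1 x.2.2.1 ∪ R' x.2.1 x.2.2.2 ∪ Q x.2.1)) :
    E.card ≤ (Fintype.card L * s ^ 2) * (9 * s ^ 2 + 8 * Fintype.card L * s) := by
  classical
  let C := L × Fin s × Fin s
  have hC : (Finset.univ : Finset C).card = Fintype.card L * s ^ 2 := by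
    rw [Finset.card_univ, Fintype.card_prod, Fintype.card_prod, Fintype.card_fin, sq]
  let K : C → Finset V := fun c => P c.1 c.2.1 ∪ R c.1 c.2.2
  let K' : C → Finset V := fun d => P' d.1 d.2.1 ∪ R' d.1 d.2.2
  have hK : ∀ c, (K c).card ≤ 4 := fun c =>
    (Finset.card_union_le _ _).trans (Nat.add_le_add (hPc _ _) (hRc _ _))
  have hK' : ∀ c, (K' c).card ≤ 4 := fun c =>
    (Finset.card_union_le _ _).trans (Nat.add_le_add (hPc' _ _) (hRc' _ _))
  -- `X d` holds the `c` whose route meets the connectors of `d`. Any other collision lies on the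
  -- long walk of `d`, and `Y c` covers it: the connectors of `c` meet at most four long walks, and
  -- the long walk of `c` meets only itself.
  let X : C → Finset C := fun d => Finset.univ.filter fun c =>
    ¬ Disjoint (K' d) (Q c.1) ∨ ¬ Disjoint (K' d) (P c.1 c.2.1) ∨ ¬ Disjoint (K' d) (R c.1 c.2.2)
  let Y : C → Finset C := fun c =>
    ((Finset.univ.filter fun l => ¬ Disjoint (K c) (Q l)) ∪ {c.1}) ×ˢ Finset.univ
  have hX : ∀ d, (X d).card ≤ 4 * s ^ 2 + 8 * Fintype.card L * s := fun d =>
    card_fiber_le Q P R hQ hP hR (K' d) (hK' d) (X d) fun c hc => (Finset.mem_filter.1 hc).2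
  have hY : ∀ c, (Y c).card ≤ 5 * s ^ 2 := by
    intro c
    rw [Finset.card_product, Finset.card_univ, Fintype.card_prod, Fintype.card_fin, sq]
    refine Nat.mul_le_mul_right _ ((Finset.card_union_le _ _).trans ?_)
    rw [Finset.card_singleton]
    exact Nat.add_le_add_right ((card_filter_not_disjoint_le Q hQ (K c)).trans (hK c)) 1
  have hsub : E ⊆ (Finset.univ.biUnion fun d => X d ×ˢ {d}) ∪
      Finset.univ.biUnion fun c => {c} ×ˢ Y c := by
    rintro ⟨c, d⟩ hx
    obtain ⟨v, hv, hv'⟩ := Finset.not_disjoint_iff.1 (hE _ hx)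
    have hXmem : (¬ Disjoint (K' d) (Q c.1) ∨ ¬ Disjoint (K' d) (P c.1 c.2.1) ∨
        ¬ Disjoint (K' d) (R c.1 c.2.2)) → (c, d) ∈ (Finset.univ.biUnion fun d => X d ×ˢ {d}) ∪
        Finset.univ.biUnion fun c => {c} ×ˢ Y c := fun h =>
      Finset.mem_union_left _ (Finset.mem_biUnion.2 ⟨d, Finset.mem_univ _,
        Finset.mem_product.2 ⟨Finset.mem_filter.2 ⟨Finset.mem_univ _, h⟩,
          Finset.mem_singleton_self _⟩⟩)
    have hYmem : (¬ Disjoint (K c) (Q d.1) ∨ d.1 = c.1) →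
        (c, d) ∈ (Finset.univ.biUnion fun d => X d ×ˢ {d}) ∪
        Finset.univ.biUnion fun c => {c} ×ˢ Y c := fun h =>
      Finset.mem_union_right _ (Finset.mem_biUnion.2 ⟨c, Finset.mem_univ _,
        Finset.mem_product.2 ⟨Finset.mem_singleton_self _, Finset.mem_product.2
          ⟨by simpa [or_comm] using h, Finset.mem_univ _⟩⟩⟩)
    rcases Finset.mem_union.1 hv' with hv' | hv'
    · apply hXmem
      rcases Finset.mem_union.1 hv with hv | hv
      · rcases Finset.mem_union.1 hv with hv | hv
        · exact Or.inr (Or.inl (Finset.not_disjoint_iff.2 ⟨v, hv', hv⟩))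
        · exact Or.inr (Or.inr (Finset.not_disjoint_iff.2 ⟨v, hv', hv⟩))
      · exact Or.inl (Finset.not_disjoint_iff.2 ⟨v, hv', hv⟩)
    · apply hYmem
      rcases Finset.mem_union.1 hv with hv | hv
      · exact Or.inl (Finset.not_disjoint_iff.2 ⟨v, hv, hv'⟩)
      · right
        by_contra hne
        exact Finset.disjoint_left.1 (hQ _ _ hne) hv' hv
  have h1 : (Finset.univ.biUnion fun d => X d ×ˢ {d}).card ≤
      (Finset.univ : Finset C).card * (4 * s ^ 2 + 8 * Fintype.card L * s) :=
    Finset.card_biUnion_le_card_mul _ _ _ fun d _ => by simpa using hX d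
  have h2 : (Finset.univ.biUnion fun c => {c} ×ˢ Y c).card ≤
      (Finset.univ : Finset C).card * (5 * s ^ 2) :=
    Finset.card_biUnion_le_card_mul _ _ _ fun c _ => by simpa using hY c
  rw [hC] at h1 h2
  have h3 := (Finset.card_le_card hsub).trans (Finset.card_union_le _ _)
  linarith

/-! ### Consequences of large degree and strong connectivity. -/

/-- There are many vertices that can be reached by many disjoint short walks. -/
theorem exists_short_links {V : Type*} [DecidableEq V] (r : V → V → Prop) [DecidableRel r]
    (hr : ∀ u v, u ≠ v → r u v ∨ r v u) (U : Finset V) {p m s : ℕ} (hp : p ≤ U.card)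
    (hm : 3 * (2 * s) + p + 1 < m) :
    ∃ I ⊆ U, I.card = p ∧ ∀ x v, m ≤ (U.filter fun b => r x b).card → v ∈ I →
      ∃ P : Fin s → Finset V, (∀ α, (P α).card ≤ 2 ∧ P α ⊆ U ∧
        ReflTransGen (RelWithin r (insert x (insert v (P α)))) x v) ∧
        ∀ α α', α ≠ α' → Disjoint (P α) (P α') := by
  obtain ⟨I, hIU, hIp, hI⟩ :=
    exists_subset_card_eq_of_max U (fun v => (U.filter fun b => r b v).card) p hp
  refine ⟨I, hIU, hIp, fun x v hx hv => ?_⟩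
  refine exists_pairwise_disjoint
    (fun P => P ⊆ U ∧ ReflTransGen (RelWithin r (insert x (insert v P))) x v) 2 s fun F hF => ?_
  obtain ⟨P, hP, hPc, hPw⟩ := exists_short_walk r hr U I hI (by rw [hIp]; exact hm) hv hx F hF
  exact ⟨P, Finset.disjoint_left.2 fun a ha => (Finset.mem_sdiff.1 (hP ha)).2, hPc,
    hP.trans Finset.sdiff_subset, hPw⟩

theorem reflTransGen_of_removeVertices {V : Type*} (G : Digraph V) (S : Set V)
    (h : (G.removeVertices S).IsStronglyConnected) {u v : V} (hu : u ∉ S) (hv : v ∉ S) :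
    ReflTransGen (fun a b => G.Adj a b ∧ a ∉ S ∧ b ∉ S) u v := by
  obtain ⟨p, hp⟩ := h ⟨u, hu⟩ ⟨v, hv⟩
  have hs := hp.start_eq
  have he := hp.end_eq
  cases p with
  | nil => simp at hs
  | cons a q =>
    obtain rfl : a = ⟨u, hu⟩ := by simpa using hs
    rw [List.getLast?_eq_some_getLast (List.cons_ne_nil _ _)] at he
    have := List.relationReflTransGen_of_exists_isChain_cons q hp.isChain (Option.some.inj he)
    exact ReflTransGen.lift (p := fun a b => G.Adj a b ∧ a ∉ S ∧ b ∉ S) Subtype.val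
      (fun a b hab => ⟨hab, a.2, b.2⟩) _ _ this

section Degree

variable {V : Type*} [Fintype V] [DecidableEq V] {G : Digraph V} [DecidableRel G.Adj] {m : ℕ}

/-- Deleting fewer than `m` out-neighbours would leave `x` without out-edges, while the vertex count
guarantees another surviving vertex that `x` must reach. -/
theorem IsStronglyKConnected.le_card_outNeighbors (h : G.IsStronglyKConnected m)
    (hG : G.IsTournament) (x : V) : m ≤ (Finset.univ.filter fun b => G.Adj x b).card := by
  by_contra! hlt
  obtain ⟨z, hz⟩ : ∃ z, z ∉ insert x (Finset.univ.filter fun b => G.Adj x b) := by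
    by_contra! hne
    have h1 := Finset.card_le_card (fun z _ => hne z : Finset.univ ⊆ _)
    have h2 := Finset.card_insert_le x (Finset.univ.filter fun b => G.Adj x b)
    rw [Finset.card_univ] at h1
    have := h.1
    omega
  rw [Finset.mem_insert, not_or] at hz
  have hw := reflTransGen_of_removeVertices G _ (h.2 _ hlt) (u := x) (v := z)
    (by simpa using hG.irrefl x) (by simpa using hz.2)
  rcases ReflTransGen.cases_head hw with heq | ⟨c, hc, -⟩
  · exact hz.1 heq.symm
  · exact hc.2.2 (by simpa using hc.1)

theorem IsStronglyKConnected.le_card_inNeighbors (h : G.IsStronglyKConnected m)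
    (hG : G.IsTournament) (x : V) : m ≤ (Finset.univ.filter fun b => G.Adj b x).card := by
  by_contra! hlt
  obtain ⟨z, hz⟩ : ∃ z, z ∉ insert x (Finset.univ.filter fun b => G.Adj b x) := by
    by_contra! hne
    have h1 := Finset.card_le_card (fun z _ => hne z : Finset.univ ⊆ _)
    have h2 := Finset.card_insert_le x (Finset.univ.filter fun b => G.Adj b x)
    rw [Finset.card_univ] at h1
    have := h.1
    omega
  rw [Finset.mem_insert, not_or] at hz
  have hw := reflTransGen_of_removeVertices G _ (h.2 _ hlt) (u := z) (v := x)
    (by simpa using hz.2) (by simpa using hG.irrefl x)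
  rcases ReflTransGen.cases_tail hw with heq | ⟨c, -, hc⟩
  · exact hz.1 heq.symm
  · exact hc.2.1 (by simpa using hc.1)

end Degree

end Digraph

/-! ### Assembling the linkage. -/

theorem mainTheorem1 {V : Type*} [Fintype V] (T : Digraph V) (hT : T.IsTournament) (k : ℕ)
    (hconn : T.IsStronglyKConnected (452 * k)) : T.IsLinked k := by
  classical
  open Digraph Relation in
  intro x y hx hy hxy
  rcases Nat.eq_zero_or_pos k with rfl | hk
  · exact ⟨fun i => i.elim0, fun i => i.elim0, fun i => i.elim0⟩
  set Z : Finset V := Finset.univ.image x ∪ Finset.univ.image y with hZ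
  have hxZ : ∀ i, x i ∈ Z := fun i =>
    Finset.mem_union_left _ (Finset.mem_image_of_mem _ (Finset.mem_univ i))
  have hyZ : ∀ i, y i ∈ Z := fun i =>
    Finset.mem_union_right _ (Finset.mem_image_of_mem _ (Finset.mem_univ i))
  have hZc : Z.card ≤ 2 * k := by
    have h1 := Finset.card_union_le (Finset.univ.image x) (Finset.univ.image y)
    have h2 : (Finset.univ.image x).card ≤ k := by
      simpa using (Finset.card_image_le (s := Finset.univ) (f := x))
    have h3 : (Finset.univ.image y).card ≤ k := by
      simpa using (Finset.card_image_le (s := Finset.univ) (f := y))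
    rw [← hZ] at h1
    omega
  set U : Finset V := Zᶜ with hU
  have hUZ : ∀ v, v ∈ U → v ∉ Z := fun v hv => Finset.mem_compl.1 hv
  have hUc : 120 * k ≤ U.card := by
    have := Finset.card_add_card_compl Z
    rw [← hU] at this
    have := hconn.1
    omega
  have htot : ∀ u v, u ≠ v → T.Adj u v ∨ T.Adj v u := fun u v huv =>
    (hT.existsUnique_edge u v huv).or
  have hdeg : ∀ N : Finset V, 452 * k ≤ N.card → 450 * k ≤ (U ∩ N).card := by
    intro N hN
    have h1 := Finset.le_card_sdiff Z N
    rw [Finset.sdiff_eq_inter_compl, Finset.inter_comm, ← hU] at h1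
    omega
  have hout : ∀ v, 450 * k ≤ (U.filter fun b => T.Adj v b).card := by
    intro v
    have := hdeg _ (hconn.le_card_outNeighbors hT v)
    rwa [Finset.inter_filter, Finset.inter_univ] at this
  have hin : ∀ v, 450 * k ≤ (U.filter fun b => T.Adj b v).card := by
    intro v
    have := hdeg _ (hconn.le_card_inNeighbors hT v)
    rwa [Finset.inter_filter, Finset.inter_univ] at this
  -- Here 3 · 100k + 120k + 1 < 450k, where 100k bounds the vertices used by the 50k connectors.
  obtain ⟨I, hIU, hIc, hI⟩ := exists_short_links T.Adj htot U hUc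
    (m := 450 * k) (s := 50 * k) (by omega)
  obtain ⟨O, hOU, hOc, hO⟩ := exists_short_links (fun u v => T.Adj v u)
    (fun u v huv => (htot u v huv).symm) U hUc (m := 450 * k) (s := 50 * k) (by omega)
  -- Requiring the head of each edge to lie in `U` keeps the walks off the terminals. A separator
  -- together with `Z` has fewer than 122k vertices.
  obtain ⟨Q, e, hQ, hQd⟩ := exists_disjoint_walks (fun u v => T.Adj u v ∧ v ∈ U) I O (by
    intro S hS
    have hIS : ∃ a ∈ I, a ∉ S := Finset.exists_mem_notMem_of_card_lt_card hS
    have hOS : ∃ b ∈ O, b ∉ S := Finset.exists_mem_notMem_of_card_lt_card (by omega)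
    obtain ⟨a, ha, haS⟩ := hIS
    obtain ⟨b, hb, hbS⟩ := hOS
    have hc : (Z ∪ S).card < 452 * k := by
      have := Finset.card_union_le Z S
      omega
    have haZ := hUZ a (hIU ha)
    have hbZ := hUZ b (hOU hb)
    refine ⟨a, ha, b, hb, haS, ReflTransGen.mono ?_ _ _
      (reflTransGen_of_removeVertices T _ (hconn.2 _ hc) (u := a) (v := b)
        (by simp [haS, haZ]) (by simp [hbS, hbZ]))⟩
    intro c d hcd
    have := hcd.2.2
    simp only [Finset.coe_union, Set.mem_union, Finset.mem_coe, not_or] at this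
    exact ⟨⟨hcd.1, Finset.mem_compl.2 this.1⟩, this.2⟩)
  have hQU : ∀ a ∈ I, Q a ⊆ U := by
    intro a ha v hv
    rcases (hQ a ha).2.2.2.2 v hv with h | ⟨u, hu⟩
    · exact hIU h
    · exact hu.2
  choose P hP hPd using fun (i : Fin k) (l : I) => hI (x i) l (hout (x i)) l.2
  choose R hR hRd using fun (i : Fin k) (l : I) => hO (y i) (e l) (hin (y i)) (hQ l l.2).1
  let C := I × Fin (50 * k) × Fin (50 * k)
  let W : Fin k → C → Finset V := fun i c => P i c.1 c.2.1 ∪ R i c.1 c.2.2 ∪ Q c.1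
  have hWU : ∀ i c, W i c ⊆ U := fun i c => Finset.union_subset
    (Finset.union_subset (hP i c.1 c.2.1).2.1 (hR i c.1 c.2.2).2.1) (hQU c.1 c.1.2)
  have hcI : Fintype.card I = 120 * k := by rw [Fintype.card_coe, hIc]
  have hCc : Fintype.card C = 120 * k * (50 * k) ^ 2 := by
    rw [Fintype.card_prod, Fintype.card_prod, hcI, Fintype.card_fin, sq]
  have hCne : Nonempty C := Fintype.card_pos_iff.1 (by rw [hCc]; positivity)
  obtain ⟨f, hf⟩ := exists_conflict_free (ι := Fin k) (C := C)
    (fun i j c d => ¬ Disjoint (W i c) (W j d)) (fun i j c d h h' => h h'.symm) (by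
      intro i j _ E hE
      have h1 := card_conflict_le (fun l : I => Q l) (P i) (R i) (P j) (R j)
        (fun l l' hl => hQd l l.2 l' l'.2 fun h => hl (Subtype.ext h)) (hPd i) (hRd i)
        (fun l α => (hP i l α).1) (fun l α => (hR i l α).1)
        (fun l α => (hP j l α).1) (fun l α => (hR j l α).1) E hE
      rw [hcI] at h1
      rw [hCc, Fintype.card_fin]
      refine (Nat.mul_le_mul_left _ h1).trans ?_
      -- With |L| = 120k and s = 50k the required inequality is 0.94 ≤ 1.
      have h2 : 4 * k * (120 * k * (50 * k) ^ 2 * (9 * (50 * k) ^ 2 + 8 * (120 * k) * (50 * k))) =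
        84600000000 * k ^ 6 := by ring
      have h3 : (120 * k * (50 * k) ^ 2) ^ 2 = 90000000000 * k ^ 6 := by ring
      rw [h2, h3]
      exact Nat.mul_le_mul_right _ (by norm_num))
  have hpath : ∀ i, ∃ p : List V, T.IsDirectedPath (x i) (y i) p ∧
      ∀ w ∈ p, w ∈ insert (x i) (insert (y i) (W i (f i))) := by
    intro i
    refine exists_isDirectedPath T _ (by simp) ?_
    obtain ⟨l, α, β⟩ := f i
    have hQl := hQ l l.2
    have h1 := (hP i l α).2.2
    have h2 := RelWithin.swap (hR i l β).2.2
    have h3 : ReflTransGen (RelWithin T.Adj (Q l)) l (e l) :=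
      ReflTransGen.mono (fun _ _ h => ⟨h.1.1, h.2⟩) _ _ hQl.2.2.2.1
    refine ((RelWithin.mono ?_ h1).trans (RelWithin.mono ?_ h3)).trans (RelWithin.mono ?_ h2)
    · intro v hv
      have := hQl.2.1
      simp only [W, Finset.mem_insert, Finset.mem_union] at hv ⊢
      rcases hv with rfl | rfl | hv <;> tauto
    · intro v hv
      simp only [W, Finset.mem_insert, Finset.mem_union]
      tauto
    · intro v hv
      have := hQl.2.2.1
      simp only [W, Finset.mem_insert, Finset.mem_union] at hv ⊢
      rcases hv with rfl | rfl | hv <;> tauto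
  choose p hp hpW using hpath
  refine ⟨p, hp, fun i j hij v hvi hvj => ?_⟩
  -- Routes meet terminals only at their own ends, so only the sets `W` could still collide.
  have hWZ : ∀ i c v, v ∈ W i c → v ∉ Z := fun i c v hv => hUZ v (hWU i c hv)
  have hi := hpW i v hvi
  have hj := hpW j v hvj
  have hdis := not_not.1 (hf i j hij)
  rcases Finset.mem_insert.1 hi with rfl | hi
  · rcases Finset.mem_insert.1 hj with h | hj
    · exact hij (hx h)
    · rcases Finset.mem_insert.1 hj with h | hj
      · exact hxy i j h
      · exact hWZ _ _ _ hj (hxZ i)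
  rcases Finset.mem_insert.1 hi with rfl | hi
  · rcases Finset.mem_insert.1 hj with h | hj
    · exact hxy j i h.symm
    · rcases Finset.mem_insert.1 hj with h | hj
      · exact hij (hy h)
      · exact hWZ _ _ _ hj (hyZ i)
  rcases Finset.mem_insert.1 hj with rfl | hj
  · exact hWZ _ _ _ hi (hxZ j)
  rcases Finset.mem_insert.1 hj with rfl | hj
  · exact hWZ _ _ _ hi (hyZ j)
  exact Finset.disjoint_left.1 hdis hi hj
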